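/- Let $X$ be a real Banach space, let $(T_t)_{t\ge 0}$ be a strongly continuous semigroup of bounded linear operators on $X$, and let $(\mu_t)_{t\ge 0}$ be a family of Borel probability measures on $X$ such that $\mu_0=\delta_0$, $t\mapsto\int_X f\,d\mu_t$ is continuous on $[0,\infty)$ for every bounded continuous $f:X\to\mathbb R$, and $\mu_{t+s}=(\mu_t\circ T_s^{-1})*\mu_s$ for all $t,s>0$. For every bounded Borel function $f:X\to\mathbb R$ put $$P_tf(x)=\int_X f(T_tx+y)\,\mu_t(dy),\qquad t\ge 0,\ x\in X.$$ A Borel probability measure $\mu$ on $X$ is called Fomin differentiable along $v\in X$ if for every Borel set $B$ the limit $d_v\mu(B)=\lim_{s\to 0}\frac{\mu(B+sv)-\mu(B)}{s}$ exists and is finite; then $d_v\mu$ is a signed measure, absolutely continuous with respect to $\mu$, and its density $\beta\in L^1(X,\mu)$ is called the Fomin derivative of $\mu$ along $v$. Assume that each $\mu_t$ is Radon, that for every $t>0$ and $h\in X$ the measure $\mu_t$ is Fomin differentiable along $T_th$, and that there are $C>0$ and $\omega,\theta\in\mathbb R$ such that the Fomin derivative $\beta_{t,h}$ of $\mu_t$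 along $T_th$ satisfies $$\|\beta_{t,h}\|_{L^1(X,\mu_t)}\le \frac{Ce^{\omega t}}{t^{\theta}}\,\|h\|,\qquad t>0,\ h\in X.$$ Then: 1. For every bounded Borel function $f:X\to\mathbb R$, every $t>0$ and every $k\in\mathbb N$, the function $P_tf$ belongs to $C^k_b(X)$, i.e. it is $k$ times continuously Fréchet differentiable on $X$, and it is bounded together with its Fréchet derivatives up to the order $k$. In particular $P_t$ is strong Feller for every $t>0$, i.e. it maps bounded Borel functions to bounded continuous functions. 2. For every bounded Borel function $f:X\to\mathbb R$, the function $(t,x)\mapsto P_tf(x)$ is continuous on $(0,\infty)\times X$. 3. For every bounded continuous function $f:X\to\mathbb R$, the function $(t,x)\mapsto P_tf(x)$ is continuous on $[0,\infty)\times X$. -/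

import Mathlib

open MeasureTheory Filter Topology
open scoped NNReal

/-- A strongly continuous semigroup of bounded linear operators on `X`, indexed by `[0, ∞)`. -/
structure IsStronglyContinuousSemigroup {X : Type*} [NormedAddCommGroup X] [NormedSpace ℝ X]
    (T : ℝ≥0 → X →L[ℝ] X) : Prop where
  zero : T 0 = ContinuousLinearMap.id ℝ X
  add : ∀ t s : ℝ≥0, T (t + s) = (T t).comp (T s)
  continuous : ∀ x : X, Continuous fun t : ℝ≥0 => T t x

/-- The data `(T, μ)` of a generalized Mehler semigroup: `T` is a strongly continuous semigroup,
`μ` is a weakly continuous family of Borel probability measures (the topology of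
`ProbabilityMeasure X` is the one of weak convergence, tested on bounded continuous functions)
with `μ 0 = δ_0` and `μ (t + s) = (μ t ∘ (T s)⁻¹) ∗ μ s`. -/
structure IsGeneralizedMehler {X : Type*} [NormedAddCommGroup X] [NormedSpace ℝ X]
    [MeasurableSpace X] [BorelSpace X]
    (T : ℝ≥0 → X →L[ℝ] X) (μ : ℝ≥0 → ProbabilityMeasure X) : Prop where
  semigroup : IsStronglyContinuousSemigroup T
  dirac : (μ 0 : Measure X) = Measure.dirac 0
  weaklyContinuous : Continuous μ
  conv : ∀ t s : ℝ≥0, 0 < t → 0 < s →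
    (μ (t + s) : Measure X) = Measure.conv ((μ t : Measure X).map (T s)) (μ s : Measure X)

/-- `P_t f (x) = ∫ f (T_t x + y) μ_t(dy)`. -/
noncomputable def mehlerOp {X : Type*} [NormedAddCommGroup X] [NormedSpace ℝ X]
    [MeasurableSpace X] [BorelSpace X]
    (T : ℝ≥0 → X →L[ℝ] X) (μ : ℝ≥0 → ProbabilityMeasure X) (t : ℝ≥0) (f : X → ℝ) (x : X) : ℝ :=
  ∫ y, f (T t x + y) ∂(μ t : Measure X)

/-- The incremental ratio `(μ(B + s v) - μ(B)) / s`. -/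
noncomputable def fominRatio {X : Type*} [NormedAddCommGroup X] [NormedSpace ℝ X]
    [MeasurableSpace X] (μ : Measure X) (v : X) (B : Set X) (s : ℝ) : ℝ :=
  (μ.real ((fun x => x + s • v) '' B) - μ.real B) / s

/-- `μ` is Fomin differentiable along `v`: for every Borel set `B` the incremental ratio
`(μ(B + s v) - μ(B)) / s` has a finite limit as `s → 0`. -/
def FominDifferentiable {X : Type*} [NormedAddCommGroup X] [NormedSpace ℝ X]
    [MeasurableSpace X] (μ : Measure X) (v : X) : Prop :=
  ∀ B : Set X, MeasurableSet B → ∃ l : ℝ, Tendsto (fominRatio μ v B) (𝓝[≠] 0) (𝓝 l)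

/-- `β` is the Fomin derivative of `μ` along `v`: the density in `L¹(μ)` of the measure
`B ↦ lim_{s → 0} (μ(B + s v) - μ(B)) / s`. It is unique up to `μ`-null sets. -/
structure IsFominDerivative {X : Type*} [NormedAddCommGroup X] [NormedSpace ℝ X]
    [MeasurableSpace X] (μ : Measure X) (v : X) (β : X → ℝ) : Prop where
  integrable : Integrable β μ
  tendsto : ∀ B : Set X, MeasurableSet B →
    Tendsto (fominRatio μ v B) (𝓝[≠] 0) (𝓝 (∫ y in B, β y ∂μ))

/-- The smoothing hypothesis with exponent `θ`: every `μ t` is Radon; for `t > 0` it is Fomin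
differentiable along the range of `T t`, and the Fomin derivative `β_{t,h}` along `T t h` satisfies
`‖β_{t,h}‖_{L¹(μ t)} ≤ C exp(ω t) t^{-θ} ‖h‖`. -/
structure MehlerSmoothing {X : Type*} [NormedAddCommGroup X] [NormedSpace ℝ X]
    [MeasurableSpace X] [BorelSpace X]
    (T : ℝ≥0 → X →L[ℝ] X) (μ : ℝ≥0 → ProbabilityMeasure X) (θ : ℝ) : Prop where
  radon : ∀ t : ℝ≥0, (μ t : Measure X).InnerRegular
  differentiable : ∀ t : ℝ≥0, 0 < t → ∀ h : X, FominDifferentiable (μ t : Measure X) (T t h)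
  bound : ∃ C : ℝ, 0 < C ∧ ∃ ω : ℝ, ∀ t : ℝ≥0, 0 < t → ∀ (h : X) (β : X → ℝ),
    IsFominDerivative (μ t : Measure X) (T t h) β →
      ∫ y, |β y| ∂(μ t : Measure X) ≤ C * Real.exp (ω * t) / (t : ℝ) ^ θ * ‖h‖

/-- `f ∈ B_b(X)`: bounded and Borel measurable. -/
def IsBoundedBorel {X : Type*} [MeasurableSpace X] (f : X → ℝ) : Prop :=
  Measurable f ∧ ∃ M : ℝ, ∀ x, |f x| ≤ M

/-- `f ∈ C_b(X)`: bounded and continuous. -/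
def IsBoundedContinuous {X : Type*} [TopologicalSpace X] (f : X → ℝ) : Prop :=
  Continuous f ∧ ∃ M : ℝ, ∀ x, |f x| ≤ M

/-- `f ∈ C^k_b(X)`: `f` is `k` times continuously Fréchet differentiable, and `f` and its Fréchet
derivatives up to the order `k` are bounded (in the norm of continuous multilinear forms). -/
def IsBoundedContDiff {X : Type*} [NormedAddCommGroup X] [NormedSpace ℝ X]
    (k : ℕ) (f : X → ℝ) : Prop :=
  ContDiff ℝ k f ∧ ∀ j : ℕ, j ≤ k → ∃ M : ℝ, ∀ x, ‖iteratedFDeriv ℝ j f x‖ ≤ M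

/-- The operator `P` is strong Feller: it maps `B_b(X)` into `C_b(X)`. -/
def IsStrongFeller {X : Type*} [TopologicalSpace X] [MeasurableSpace X]
    (P : (X → ℝ) → (X → ℝ)) : Prop :=
  ∀ f : X → ℝ, IsBoundedBorel f → IsBoundedContinuous (P f)

/-! Moving `x` by `h` in `P_t f(x)` moves the integration variable by `T_t h`. A Fomin derivative
`β` along `T_t h` gives `|μ_t(B + s T_t h) - μ_t(B)| ≤ ‖β‖ |s|`, so `P_t` sends bounded Borel
functions to Lipschitz ones, with a constant proportional to `sup |f|`. That such a `β` exists is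
Nikodym's convergence theorem followed by Radon–Nikodym.

Higher orders need no further differentiability of `μ_t`. With `P_t = P_{t/2} P_{t/2}` and `Δ_k P_s
= P_s Δ_{T_s k}`, one has `Δ_k P_t f = P_{t/2} g`, where `g = Δ_{T_{t/2} k} P_{t/2} f` is bounded by
a multiple of `‖k‖ sup |f|`. Iteration bounds the differences of all orders, and a function with
such bounds is smooth with bounded derivatives.

For continuous `f`, joint continuity follows from that of `T` and from weak continuity of `μ`,
tightness being needed only at the limit measure. For Borel `f`, it follows by writing `P_r f =
P_{r-t/2} (P_{t/2} f)` for `r` near `t`. -/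

/-! ### Smoothness from bounded iterated differences. -/

section FiniteDifferences

variable {E : Type*} [NormedAddCommGroup E] {F : Type*} [NormedAddCommGroup F]

/-- The `n`-th iterated differences `Δ_{h₁} ⋯ Δ_{hₙ} u` are bounded by `C ‖h₁‖ ⋯ ‖hₙ‖`. -/
def DiffBounded : ℕ → ℝ → (E → F) → Prop
  | 0, C, u => ∀ x, ‖u x‖ ≤ C
  | n + 1, C, u => ∀ h, DiffBounded n (C * ‖h‖) (fwdDiff h u)

lemma DiffBounded.mono {n : ℕ} {C D : ℝ} {u : E → F} (hu : DiffBounded n C u) (h : C ≤ D) :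
    DiffBounded n D u := by
  induction n generalizing C D u with
  | zero => exact fun x => (hu x).trans h
  | succ n ih => exact fun k => ih (hu k) (by gcongr)

lemma DiffBounded.norm_sub_le {C : ℝ} {u : E → F} (hu : DiffBounded 1 C u) (x h : E) :
    ‖u (x + h) - u x‖ ≤ C * ‖h‖ :=
  hu h x

lemma DiffBounded.norm_sub_sub_le {C : ℝ} {u : E → F} (hu : DiffBounded 2 C u) (x h k : E) :
    ‖u (x + h + k) - u (x + h) - (u (x + k) - u x)‖ ≤ C * ‖h‖ * ‖k‖ := by
  have := hu k h x
  simp only [fwdDiff] at this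
  linarith

lemma DiffBounded.continuous {C : ℝ} {u : E → F} (hu : DiffBounded 1 C u) : Continuous u := by
  refine (LipschitzWith.of_dist_le_mul (K := C.toNNReal) fun x y => ?_).continuous
  rw [dist_eq_norm, dist_eq_norm]
  calc ‖u x - u y‖ = ‖u (y + (x - y)) - u y‖ := by rw [add_sub_cancel]
    _ ≤ C * ‖x - y‖ := hu.norm_sub_le y (x - y)
    _ ≤ C.toNNReal * ‖x - y‖ := by gcongr; exact Real.le_coe_toNNReal C

variable [NormedSpace ℝ E] [NormedSpace ℝ F]

/-- Bounded iterated differences pass from a function to its derivative, at one order less. -/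
lemma DiffBounded.of_hasFDerivAt {n : ℕ} {C : ℝ} (hC : 0 ≤ C) {u : E → F} {A : E → E →L[ℝ] F}
    (hA : ∀ x, HasFDerivAt u (A x) x) (hu : DiffBounded (n + 1) C u) : DiffBounded n C A := by
  induction n generalizing C u A with
  | zero =>
    intro x
    refine (hA x).le_of_lip' hC (Eventually.of_forall fun y => ?_)
    simpa using hu.norm_sub_le x (y - x)
  | succ n ih =>
    intro h
    refine ih (by positivity) (fun x => ?_) (hu h)
    -- `Δ_h u` has derivative `Δ_h A`, so the induction runs on this pair.
    exact ((hasFDerivAt_comp_add_right h).2 (hA (x + h))).sub (hA x)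

/-- A function with bounded first and second differences is Fréchet differentiable. -/
lemma DiffBounded.exists_hasFDerivAt [CompleteSpace F] {C D : ℝ} {u : E → F}
    (h1 : DiffBounded 1 C u) (h2 : DiffBounded 2 D u) (x : E) :
    ∃ A : E →L[ℝ] F, HasFDerivAt u A x := by
  -- Dyadic difference quotients. The second difference with both steps equal to `2^{-(n+1)} h`
  -- controls consecutive terms, and the geometric sum yields the quadratic remainder `D / 2 * ‖h‖ ^
  -- 2`.
  let q : E → ℕ → F := fun h n => (2 : ℝ) ^ n • (u (x + ((2 : ℝ) ^ n)⁻¹ • h) - u x)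
  have hq0 : ∀ h, q h 0 = u (x + h) - u x := fun h => by simp [q]
  have hstep : ∀ h n, dist (q h n) (q h (n + 1)) ≤ D / 2 * ‖h‖ ^ 2 / 2 / 2 ^ n := by
    intro h n
    have hk := h2.norm_sub_sub_le x (((2 : ℝ) ^ (n + 1))⁻¹ • h) (((2 : ℝ) ^ (n + 1))⁻¹ • h)
    have e : ((2 : ℝ) ^ (n + 1))⁻¹ • h + ((2 : ℝ) ^ (n + 1))⁻¹ • h = ((2 : ℝ) ^ n)⁻¹ • h := by
      rw [← add_smul]; congr 1; rw [pow_succ]; field_simp; norm_num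
    rw [add_assoc, e] at hk
    have e2 : q h n - q h (n + 1) = (2 : ℝ) ^ n • (u (x + ((2 : ℝ) ^ n)⁻¹ • h) -
        u (x + ((2 : ℝ) ^ (n + 1))⁻¹ • h) - (u (x + ((2 : ℝ) ^ (n + 1))⁻¹ • h) - u x)) := by
      simp only [q, pow_succ]; module
    rw [dist_eq_norm, e2, norm_smul]
    calc ‖(2 : ℝ) ^ n‖ * _ ≤ ‖(2 : ℝ) ^ n‖ * _ := mul_le_mul_of_nonneg_left hk (norm_nonneg _)
      _ = D / 2 * ‖h‖ ^ 2 / 2 / 2 ^ n := by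
        rw [norm_smul]; simp only [norm_inv, norm_pow, Real.norm_ofNat, pow_succ, norm_mul]
        field_simp
  choose A hA using fun h => cauchySeq_tendsto_of_complete
    (cauchySeq_of_le_geometric_two (hstep h))
  have hclose : ∀ h, ‖u (x + h) - u x - A h‖ ≤ D / 2 * ‖h‖ ^ 2 := fun h => by
    rw [← hq0, ← dist_eq_norm]
    exact dist_le_of_le_geometric_two_of_tendsto₀ (hstep h) (hA h)
  have hbound : ∀ h, ‖A h‖ ≤ C * ‖h‖ := fun h => by
    refine le_of_tendsto (hA h).norm (Eventually.of_forall fun n => ?_)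
    have := h1.norm_sub_le x (((2 : ℝ) ^ n)⁻¹ • h)
    simp only [q, norm_smul]
    calc ‖(2 : ℝ) ^ n‖ * _ ≤ ‖(2 : ℝ) ^ n‖ * _ := mul_le_mul_of_nonneg_left this (norm_nonneg _)
      _ = C * ‖h‖ := by
        rw [norm_smul]; simp only [norm_inv, norm_pow, Real.norm_ofNat]; field_simp
  -- The additivity defect at level `n` is `2^n` times a second difference with steps of order
  -- `2^{-n}`, hence `O(2^{-n})`.
  have hadd : ∀ h k, A (h + k) = A h + A k := fun h k => by
    have hlim : Tendsto (fun n => q (h + k) n - (q h n + q k n)) atTop (𝓝 0) := by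
      have h0 : Tendsto (fun n : ℕ => D * ‖h‖ * ‖k‖ * ((2 : ℝ)⁻¹) ^ n) atTop (𝓝 0) := by
        simpa using (tendsto_pow_atTop_nhds_zero_of_lt_one (r := (2 : ℝ)⁻¹)
          (by norm_num) (by norm_num)).const_mul (D * ‖h‖ * ‖k‖)
      refine squeeze_zero_norm (fun n => ?_) h0
      have hk := h2.norm_sub_sub_le x (((2 : ℝ) ^ n)⁻¹ • h) (((2 : ℝ) ^ n)⁻¹ • k)
      have e2 : q (h + k) n - (q h n + q k n) =
          (2 : ℝ) ^ n • (u (x + ((2 : ℝ) ^ n)⁻¹ • h + ((2 : ℝ) ^ n)⁻¹ • k) -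
          u (x + ((2 : ℝ) ^ n)⁻¹ • h) - (u (x + ((2 : ℝ) ^ n)⁻¹ • k) - u x)) := by
        simp only [q, smul_add, ← add_assoc]; module
      rw [e2, norm_smul]
      calc ‖(2 : ℝ) ^ n‖ * _ ≤ ‖(2 : ℝ) ^ n‖ * _ := mul_le_mul_of_nonneg_left hk (norm_nonneg _)
        _ = D * ‖h‖ * ‖k‖ * ((2 : ℝ)⁻¹) ^ n := by
          rw [norm_smul, norm_smul]; simp only [norm_inv, norm_pow, Real.norm_ofNat, inv_pow]
          field_simp
    have := tendsto_nhds_unique hlim ((hA (h + k)).sub ((hA h).add (hA k)))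
    exact (sub_eq_zero.1 this.symm)
  let A' : E →+ F := AddMonoidHom.mk' A hadd
  have hcont : Continuous A' := AddMonoidHomClass.continuous_of_bound A' C hbound
  refine ⟨A'.toRealLinearMap hcont, ?_⟩
  rw [hasFDerivAt_iff_isLittleO_nhds_zero]
  refine Asymptotics.IsBigO.trans_isLittleO (g := fun h : E => ‖h‖ ^ 2)
    (Asymptotics.IsBigO.of_bound (D / 2) (Eventually.of_forall fun h => ?_)) ?_
  · simpa using! hclose h
  · exact Asymptotics.isLittleO_norm_pow_id one_lt_two

lemma contDiff_and_bounded_of_diffBounded_zero {u : E → F}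
    (hu : ∀ n, ∃ C, 0 ≤ C ∧ DiffBounded n C u) :
    ContDiff ℝ (0 : ℕ) u ∧ ∃ M, ∀ x, ‖iteratedFDeriv ℝ 0 u x‖ ≤ M := by
  obtain ⟨C, -, hC⟩ := hu 0
  obtain ⟨D, -, hD⟩ := hu 1
  exact ⟨contDiff_zero.2 hD.continuous, C, fun x => by simpa using hC x⟩

lemma contDiff_and_bounded_of_fderiv {u : E → F} {k : ℕ} (hd : Differentiable ℝ u)
    (h : ContDiff ℝ k (fderiv ℝ u) ∧ ∃ M, ∀ x, ‖iteratedFDeriv ℝ k (fderiv ℝ u) x‖ ≤ M) :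
    ContDiff ℝ (k + 1 : ℕ) u ∧ ∃ M, ∀ x, ‖iteratedFDeriv ℝ (k + 1) u x‖ ≤ M := by
  obtain ⟨h1, M, hM⟩ := h
  refine ⟨?_, M, fun x => ?_⟩
  · push_cast
    rw [contDiff_succ_iff_fderiv]
    exact ⟨hd, by simp, h1⟩
  · rw [← norm_iteratedFDeriv_fderiv]
    exact hM x

lemma differentiable_and_diffBounded_fderiv [CompleteSpace F] {u : E → F}
    (hu : ∀ n, ∃ C, 0 ≤ C ∧ DiffBounded n C u) :
    Differentiable ℝ u ∧ ∀ n, ∃ C, 0 ≤ C ∧ DiffBounded n C (fderiv ℝ u) := by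
  obtain ⟨C, -, hC⟩ := hu 1
  obtain ⟨D, -, hD⟩ := hu 2
  have hd : Differentiable ℝ u := fun x => (hC.exists_hasFDerivAt hD x).elim
    fun A hA => hA.differentiableAt
  refine ⟨hd, fun n => ?_⟩
  obtain ⟨K, hK, hn⟩ := hu (n + 1)
  exact ⟨K, hK, hn.of_hasFDerivAt hK fun x => (hd x).hasFDerivAt⟩

end FiniteDifferences

universe u

/-- The induction passes from `F` to `E →L[ℝ] F`, so both spaces must live in one universe. -/
lemma contDiff_and_bounded_of_diffBounded {E : Type u} [NormedAddCommGroup E]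
    [NormedSpace ℝ E] (k : ℕ) : ∀ {F : Type u} [NormedAddCommGroup F] [NormedSpace ℝ F]
    [CompleteSpace F] {u : E → F}, (∀ n, ∃ C, 0 ≤ C ∧ DiffBounded n C u) →
    ContDiff ℝ k u ∧ ∃ M, ∀ x, ‖iteratedFDeriv ℝ k u x‖ ≤ M := by
  induction k with
  | zero => exact fun hu => contDiff_and_bounded_of_diffBounded_zero hu
  | succ k ih =>
    intro F _ _ _ u hu
    obtain ⟨hd, hb⟩ := differentiable_and_diffBounded_fderiv hu
    exact contDiff_and_bounded_of_fderiv hd (ih hb)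

/-- A real function whose iterated differences of all orders are bounded is smooth, with bounded
derivatives of all orders. -/
lemma isBoundedContDiff_of_diffBounded {E : Type*} [NormedAddCommGroup E] [NormedSpace ℝ E]
    {u : E → ℝ} (hu : ∀ n, ∃ C, 0 ≤ C ∧ DiffBounded n C u) (k : ℕ) : IsBoundedContDiff k u := by
  have key : ∀ j : ℕ, ContDiff ℝ j u ∧ ∃ M, ∀ x, ‖iteratedFDeriv ℝ j u x‖ ≤ M := by
    -- The first derivative is taken by hand: `E →L[ℝ] ℝ` lives in the universe of `E`, whereas `ℝ`
    -- need not.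
    rintro (_ | j)
    · exact contDiff_and_bounded_of_diffBounded_zero hu
    · obtain ⟨hd, hb⟩ := differentiable_and_diffBounded_fderiv hu
      exact contDiff_and_bounded_of_fderiv hd (contDiff_and_bounded_of_diffBounded j hb)
  exact ⟨(key k).1, fun j _ => (key j).2⟩

/-! ### Nikodym's convergence theorem, by Baire category on Cantor space. -/

section Nikodym

variable {α : Type*} [MeasurableSpace α]

/-- The union of the members of the sequence `B` selected by `S`. -/
def selectedUnion (B : ℕ → Set α) (S : ℕ → Prop) : Set α := ⋃ n, {x | S n ∧ x ∈ B n}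

lemma measurableSet_setOf_and {B : Set α} (hB : MeasurableSet B) (p : Prop) :
    MeasurableSet {x | p ∧ x ∈ B} := by
  by_cases h : p <;> simp [h, hB]

lemma measurableSet_selectedUnion {B : ℕ → Set α} (hB : ∀ n, MeasurableSet (B n))
    (S : ℕ → Prop) : MeasurableSet (selectedUnion B S) :=
  MeasurableSet.iUnion fun n => measurableSet_setOf_and (hB n) _

lemma signedMeasure_selectedUnion (ν : SignedMeasure α) {B : ℕ → Set α}
    (hB : ∀ n, MeasurableSet (B n)) (hd : Pairwise (Function.onFun Disjoint B))
    (S : ℕ → Prop) [DecidablePred S] :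
    ν (selectedUnion B S) = ∑' n, if S n then ν (B n) else 0 := by
  rw [selectedUnion, VectorMeasure.of_disjoint_iUnion
    (fun n => measurableSet_setOf_and (hB n) _)]
  · refine tsum_congr fun n => ?_
    by_cases h : S n <;> simp [h]
  · intro i j hij
    exact (hd hij).mono (fun x hx => hx.2) (fun x hx => hx.2)

lemma continuous_signedMeasure_selectedUnion (ν : SignedMeasure α) {B : ℕ → Set α}
    (hB : ∀ n, MeasurableSet (B n)) (hd : Pairwise (Function.onFun Disjoint B)) :
    Continuous fun S : ℕ → Bool => ν (selectedUnion B fun n => S n = true) := by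
  simp_rw [signedMeasure_selectedUnion ν hB hd]
  refine continuous_tsum (u := fun n => |ν (B n)|) (fun n => ?_)
    (ν.m_iUnion hB hd).summable.abs (fun n S => ?_)
  · exact (continuous_of_discreteTopology (f := fun b : Bool => if b = true then ν (B n) else 0)).comp
      (continuous_apply n)
  · split_ifs <;> simp

/-- The key step of Nikodym's convergence theorem: a setwise limit of signed measures is continuous
at `∅` along the unions of subfamilies of a disjoint sequence. -/
lemma tendsto_selectedUnion_of_setwise_limit {ν : ℕ → SignedMeasure α} {l : Set α → ℝ}
    (hl : ∀ B, MeasurableSet B → Tendsto (fun n => ν n B) atTop (𝓝 (l B)))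
    {B : ℕ → Set α} (hB : ∀ n, MeasurableSet (B n)) (hd : Pairwise (Function.onFun Disjoint B)) :
    Tendsto (fun S : ℕ → Bool => l (selectedUnion B fun n => S n = true))
      (𝓝 fun _ => false) (𝓝 0) := by
  rw [Metric.tendsto_nhds]
  intro ε hε
  let w : ℕ → (ℕ → Bool) → ℝ := fun k S => ν k (selectedUnion B fun n => S n = true)
  have hw : ∀ k, Continuous (w k) := fun k => continuous_signedMeasure_selectedUnion (ν k) hB hd
  let A : ℕ → Set (ℕ → Bool) := fun N => {S | ∀ j, N ≤ j → |w j S - w N S| ≤ ε / 4}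
  have hA : ∀ N, IsClosed (A N) := fun N => by
    simp only [A, Set.ofPred_forall]
    exact isClosed_iInter fun j => isClosed_iInter fun _ =>
      isClosed_le ((hw j).sub (hw N)).abs continuous_const
  have hU : ⋃ N, A N = Set.univ := by
    refine Set.eq_univ_of_forall fun S => Set.mem_iUnion.2 ?_
    have hc := (hl _ (measurableSet_selectedUnion hB fun n => S n = true)).cauchySeq
    obtain ⟨N, hN⟩ := Metric.cauchySeq_iff'.1 hc (ε / 4) (by positivity)
    exact ⟨N, fun j hj => (hN j hj).le⟩
  -- Baire: some `A N` contains a cylinder, given by finitely many coordinates `I` around `S₀`.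
  obtain ⟨N, S₀, hS₀⟩ := nonempty_interior_of_iUnion_of_closed hA hU
  have hS₀' : A N ∈ 𝓝 S₀ := mem_interior_iff_mem_nhds.1 hS₀
  rw [nhds_pi, Filter.mem_pi'] at hS₀'
  obtain ⟨I, t, ht, hI⟩ := hS₀'
  have hmem : ∀ S : ℕ → Bool, (∀ i ∈ I, S i = S₀ i) → S ∈ A N := fun S hS =>
    hI fun i hi => by rw [hS i hi]; exact mem_of_mem_nhds (ht i)
  have hev1 : ∀ᶠ S : ℕ → Bool in 𝓝 fun _ => false, ∀ i ∈ I, S i = false := by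
    rw [Filter.eventually_all_finset]
    intro i _
    exact (continuous_apply (A := fun _ : ℕ => Bool) i).tendsto (fun _ => false)
      (mem_nhds_discrete.2 rfl : {false} ∈ 𝓝 false)
  have hev2 : ∀ᶠ S : ℕ → Bool in 𝓝 fun _ => false, |w N S| < ε / 4 := by
    have h0 : w N (fun _ => false) = 0 := by simp [w, selectedUnion]
    have := (hw N).abs.tendsto (fun _ => false)
    rw [h0, abs_zero] at this
    exact this.eventually (gt_mem_nhds (by positivity))
  filter_upwards [hev1, hev2] with S hS hSN
  -- Near the zero sequence `S` vanishes on `I`, so its selection is that of `S₁` minus that of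
  -- `S₂`. Both lie in the cylinder, which moves the uniform estimate from `S₀` to zero at the cost
  -- of `2 * (ε / 4)`.
  let S₁ : ℕ → Bool := fun n => if n ∈ I then S₀ n else S n
  let S₂ : ℕ → Bool := fun n => if n ∈ I then S₀ n else false
  have h1 : S₁ ∈ A N := hmem _ fun i hi => by simp [S₁, hi]
  have h2 : S₂ ∈ A N := hmem _ fun i hi => by simp [S₂, hi]
  have hsum : ∀ k, w k S₁ = w k S + w k S₂ := fun k => by
    simp only [w]
    rw [← VectorMeasure.of_union _ (measurableSet_selectedUnion hB _)
      (measurableSet_selectedUnion hB _)]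
    · congr 1
      ext x
      simp only [selectedUnion, Set.mem_iUnion, Set.mem_ofPred_eq, Set.mem_union, ← exists_or]
      refine exists_congr fun n => ?_
      by_cases hn : n ∈ I
      · simp [S₁, S₂, hn, hS n hn]
      · simp [S₁, S₂, hn]
    · rw [Set.disjoint_left]
      simp only [selectedUnion, Set.mem_iUnion, Set.mem_ofPred_eq, not_exists]
      rintro x ⟨n, hn, hx⟩ m ⟨hm, hxm⟩
      have hnm : n = m := by
        by_contra hne
        exact Set.disjoint_left.1 (hd hne) hx hxm
      subst hnm
      by_cases hnI : n ∈ I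
      · simp [hS n hnI] at hn
      · simp [S₂, hnI] at hm
  have hlim : |l (selectedUnion B fun n => S n = true)| ≤ 3 * (ε / 4) := by
    refine le_of_tendsto (hl _ (measurableSet_selectedUnion hB _)).abs
      (eventually_atTop.2 ⟨N, fun j hj => ?_⟩)
    have b1 := abs_le.1 (h1 j hj)
    have b2 := abs_le.1 (h2 j hj)
    have b3 := abs_lt.1 hSN
    rw [hsum, hsum] at b1
    change |w j S| ≤ _
    rw [abs_le]
    constructor <;> linarith [b1.1, b1.2, b2.1, b2.2, b3.1, b3.2]
  rw [Real.dist_eq, sub_zero]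
  linarith

/-- **Nikodym's convergence theorem**: a setwise limit of signed measures is countably additive. -/
theorem hasSum_of_setwise_limit {ν : ℕ → SignedMeasure α} {l : Set α → ℝ}
    (hl : ∀ B, MeasurableSet B → Tendsto (fun n => ν n B) atTop (𝓝 (l B)))
    {B : ℕ → Set α} (hB : ∀ n, MeasurableSet (B n)) (hd : Pairwise (Function.onFun Disjoint B)) :
    HasSum (fun n => l (B n)) (l (⋃ n, B n)) := by
  have hfin : ∀ I : Finset ℕ, ∑ i ∈ I, l (B i) =
      l (⋃ n, B n) - l (selectedUnion B fun n => decide (n ∉ I) = true) := fun I => by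
    have hS := measurableSet_selectedUnion hB fun n => decide (n ∉ I) = true
    refine tendsto_nhds_unique (tendsto_finsetSum I fun i _ => hl _ (hB i))
      (((hl _ (MeasurableSet.iUnion hB)).sub (hl _ hS)).congr fun k => ?_)
    rw [signedMeasure_selectedUnion _ hB hd, VectorMeasure.of_disjoint_iUnion hB hd]
    have hsm := ((ν k).m_iUnion hB hd).summable
    rw [← hsm.sum_add_tsum_compl (s := I),
      tsum_subtype (↑I : Set ℕ)ᶜ fun n => ν k (B n), sub_eq_iff_eq_add]
    congr 1
    refine tsum_congr fun n => ?_
    by_cases h : n ∈ I <;> simp [h]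
  -- The tails left out by growing finite sets tend to the zero sequence in the product topology.
  have hT : Tendsto (fun I : Finset ℕ => fun n => decide (n ∉ I)) atTop (𝓝 fun _ => false) := by
    rw [tendsto_pi_nhds]
    intro n
    refine tendsto_const_nhds.congr' ?_
    filter_upwards [eventually_ge_atTop {n}] with I hI
    simpa using hI
  have h := (tendsto_selectedUnion_of_setwise_limit hl hB hd).comp hT
  unfold HasSum
  simp_rw [hfin]
  simpa using! h.const_sub (l (⋃ n, B n))

/-- The signed measure which is the setwise limit of a sequence of signed measures. -/
theorem exists_signedMeasure_of_setwise_limit {ν : ℕ → SignedMeasure α} {l : Set α → ℝ}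
    (hl : ∀ B, MeasurableSet B → Tendsto (fun n => ν n B) atTop (𝓝 (l B))) :
    ∃ m : SignedMeasure α, ∀ B, MeasurableSet B → m B = l B := by
  classical
  refine ⟨⟨fun B => if MeasurableSet B then l B else 0, ?_, fun B hB => if_neg hB, ?_⟩,
    fun B hB => if_pos hB⟩
  · have := hl ∅ MeasurableSet.empty
    simp only [VectorMeasure.empty] at this
    simpa using tendsto_nhds_unique this tendsto_const_nhds
  · intro B hB hd
    simp only [hB, MeasurableSet.iUnion hB, if_true]
    exact hasSum_of_setwise_limit hl hB hd

end Nikodym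

/-! ### Fomin derivatives and translation estimates. -/

section Fomin

lemma image_add_eq_preimage {X : Type*} [AddGroup X] (B : Set X) (w : X) :
    (fun x => x + w) '' B = (fun x => x + -w) ⁻¹' B := by
  simp [Set.image_add_right]

variable {X : Type*} [NormedAddCommGroup X] [MeasurableSpace X] [BorelSpace X]

lemma measurableSet_image_add {B : Set X} (hB : MeasurableSet B) (w : X) :
    MeasurableSet ((fun x => x + w) '' B) := by
  rw [image_add_eq_preimage]
  exact (measurable_add_const _) hB

variable [NormedSpace ℝ X] {μ : Measure X}

/-- A Fomin differentiable measure has a Fomin derivative. -/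
theorem FominDifferentiable.exists_isFominDerivative [IsFiniteMeasure μ] {v : X}
    (h : FominDifferentiable μ v) : ∃ β, IsFominDerivative μ v β := by
  choose! l hl using h
  let s : ℕ → ℝ := fun n => 1 / ((n : ℝ) + 1)
  have hs : Tendsto s atTop (𝓝[≠] 0) := tendsto_nhdsWithin_iff.2
    ⟨tendsto_one_div_add_atTop_nhds_zero_nat, Eventually.of_forall fun n => by
      simp only [s, Set.mem_compl_iff, Set.mem_singleton_iff]; positivity⟩
  let ν : ℕ → SignedMeasure X := fun n => (s n)⁻¹ •
    ((μ.map fun x => x + -(s n • v)).toSignedMeasure - μ.toSignedMeasure)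
  have hν : ∀ n B, MeasurableSet B → ν n B = fominRatio μ v B (s n) := by
    intro n B hB
    simp only [ν, fominRatio, smul_apply, sub_apply, smul_eq_mul]
    rw [Measure.toSignedMeasure_apply_measurable hB, Measure.toSignedMeasure_apply_measurable hB,
      map_measureReal_apply (measurable_add_const _) hB, ← image_add_eq_preimage, div_eq_inv_mul]
  obtain ⟨m, hm⟩ := exists_signedMeasure_of_setwise_limit (ν := ν) (l := l)
    fun B hB => ((hl B hB).comp hs).congr fun n => (hν n B hB).symm
  -- If `μ B = 0`, the ratio has the sign of `r`; the two one-sided limits then force the limit to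
  -- be zero.
  have hac : m ≪ᵥ μ.toENNRealVectorMeasure := by
    refine VectorMeasure.AbsolutelyContinuous.mk fun B hB h0 => ?_
    rw [Measure.toENNRealVectorMeasure_apply_measurable hB] at h0
    have hr : ∀ r, fominRatio μ v B r = μ.real ((fun x => x + r • v) '' B) / r := fun r => by
      simp [fominRatio, Measure.real, h0]
    rw [hm B hB]
    refine le_antisymm ?_ ?_
    · refine le_of_tendsto ((hl B hB).mono_left (nhdsLT_le_nhdsNE 0)) ?_
      filter_upwards [self_mem_nhdsWithin] with r hr0
      rw [hr]
      exact div_nonpos_of_nonneg_of_nonpos measureReal_nonneg (le_of_lt hr0)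
    · refine ge_of_tendsto ((hl B hB).mono_left (nhdsGT_le_nhdsNE 0)) ?_
      filter_upwards [self_mem_nhdsWithin] with r hr0
      rw [hr]
      exact div_nonneg measureReal_nonneg (le_of_lt hr0)
  have hd := SignedMeasure.withDensityᵥ_rnDeriv_eq m μ hac
  refine ⟨m.rnDeriv μ, SignedMeasure.integrable_rnDeriv m μ, fun B hB => ?_⟩
  rw [← withDensityᵥ_apply (SignedMeasure.integrable_rnDeriv m μ) hB, hd, hm B hB]
  exact hl B hB

/-- Translates of a measure with Fomin derivative `β` along `v` differ setwise by at most
`‖β‖_{L¹}`. -/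
theorem IsFominDerivative.abs_measureReal_image_sub_le [IsFiniteMeasure μ] {v : X} {β : X → ℝ}
    (h : IsFominDerivative μ v β) {B : Set X} (hB : MeasurableSet B) (s : ℝ) :
    |μ.real ((fun x => x + s • v) '' B) - μ.real B| ≤ (∫ y, |β y| ∂μ) * |s| := by
  -- The derivative at `r` is the Fomin limit for the translated set `B + r v`; the mean value
  -- inequality concludes.
  have hderiv : ∀ r : ℝ, HasDerivAt (fun r : ℝ => μ.real ((fun x => x + r • v) '' B))
      (∫ y in (fun x => x + r • v) '' B, β y ∂μ) r := fun r => by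
    rw [hasDerivAt_iff_tendsto_slope_zero]
    refine (h.tendsto _ (measurableSet_image_add hB (r • v))).congr fun t => ?_
    simp only [fominRatio, Set.image_image, smul_eq_mul, add_smul, ← add_assoc]
    rw [div_eq_inv_mul]
  have hbound : ∀ r : ℝ, ‖∫ y in (fun x => x + r • v) '' B, β y ∂μ‖ ≤ ∫ y, |β y| ∂μ := fun r =>
    (norm_integral_le_integral_norm _).trans
      (setIntegral_le_integral h.integrable.norm (Eventually.of_forall fun _ => norm_nonneg _))
  have := Convex.norm_image_sub_le_of_norm_hasDerivWithin_le (s := Set.univ) (x := 0) (y := s)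
    (fun r _ => (hderiv r).hasDerivWithinAt) (fun r _ => hbound r) convex_univ trivial trivial
  simpa using this

/-- Layer cake: both integrals are integrals over levels in `(0, M]` of the measures of superlevel
sets. -/
lemma abs_integral_sub_integral_le_of_nonneg {α : Type*} [MeasurableSpace α] {μ ν : Measure α}
    [IsFiniteMeasure μ] [IsFiniteMeasure ν] {K M : ℝ} (hM : 0 ≤ M)
    (hK : ∀ B, MeasurableSet B → |μ.real B - ν.real B| ≤ K) {f : α → ℝ} (hf : Measurable f)
    (h0 : ∀ x, 0 ≤ f x) (h1 : ∀ x, f x ≤ M) :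
    |∫ x, f x ∂μ - ∫ x, f x ∂ν| ≤ K * M := by
  have hint : ∀ (ρ : Measure α) [IsFiniteMeasure ρ], Integrable f ρ := fun ρ _ =>
    Integrable.of_bound hf.aestronglyMeasurable M
      (Eventually.of_forall fun x => by rw [Real.norm_eq_abs, abs_of_nonneg (h0 x)]; exact h1 x)
  have hm : ∀ (ρ : Measure α) [IsFiniteMeasure ρ],
      IntegrableOn (fun t : ℝ => ρ.real {a | t ≤ f a}) (Set.Ioc 0 M) := fun ρ _ =>
    (AntitoneOn.integrableOn_isCompact isCompact_Icc fun a _ b _ hab =>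
      measureReal_mono fun x (hx : b ≤ f x) => hab.trans hx).mono_set Set.Ioc_subset_Icc_self
  rw [(hint μ).integral_eq_integral_Ioc_meas_le (Eventually.of_forall h0) (Eventually.of_forall h1),
    (hint ν).integral_eq_integral_Ioc_meas_le (Eventually.of_forall h0) (Eventually.of_forall h1),
    ← integral_sub (hm μ) (hm ν), ← Real.norm_eq_abs]
  refine (norm_setIntegral_le_of_norm_le_const (C := K) (by simp) fun t _ => ?_).trans_eq ?_
  · exact hK _ (measurableSet_le measurable_const hf)
  · simp [hM]

/-- Adding `M` gives values in `[0, 2M]`, and the added constant cancels because both measures have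
mass one. -/
lemma abs_integral_sub_integral_le {α : Type*} [MeasurableSpace α] {μ ν : Measure α}
    [IsProbabilityMeasure μ] [IsProbabilityMeasure ν] {K M : ℝ}
    (hK : ∀ B, MeasurableSet B → |μ.real B - ν.real B| ≤ K) {f : α → ℝ} (hf : Measurable f)
    (hM : ∀ x, |f x| ≤ M) :
    |∫ x, f x ∂μ - ∫ x, f x ∂ν| ≤ K * (2 * M) := by
  have hM0 : 0 ≤ M := by
    obtain ⟨x⟩ := (inferInstance : (ae μ).NeBot).nonempty
    exact (abs_nonneg _).trans (hM x)
  have hint : ∀ (ρ : Measure α) [IsFiniteMeasure ρ], Integrable f ρ := fun ρ _ =>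
    Integrable.of_bound hf.aestronglyMeasurable M (Eventually.of_forall hM)
  have := abs_integral_sub_integral_le_of_nonneg (M := 2 * M) (by positivity) hK
    (hf.add_const M) (fun x => by linarith [(abs_le.1 (hM x)).1])
    (fun x => by linarith [(abs_le.1 (hM x)).2])
  rw [integral_add (hint μ) (integrable_const _), integral_add (hint ν) (integrable_const _)] at this
  simpa using this

/-- The translation estimate for integrals of bounded Borel functions. -/
theorem IsFominDerivative.abs_integral_add_sub_le [IsProbabilityMeasure μ] {v : X} {β : X → ℝ}
    (h : IsFominDerivative μ v β) {f : X → ℝ} (hf : Measurable f) {M : ℝ} (hM : ∀ x, |f x| ≤ M) :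
    |∫ y, f (y + v) ∂μ - ∫ y, f y ∂μ| ≤ (∫ y, |β y| ∂μ) * (2 * M) := by
  have := Measure.isProbabilityMeasure_map (μ := μ) (f := fun x : X => x + v)
    (measurable_add_const v).aemeasurable
  rw [← integral_map (measurable_add_const v).aemeasurable hf.aestronglyMeasurable]
  refine abs_integral_sub_integral_le (fun B hB => ?_) hf hM
  rw [map_measureReal_apply (measurable_add_const v) hB]
  -- The preimage of `B` under translation by `v` is its image under translation by `-v`.
  have := h.abs_measureReal_image_sub_le hB (-1)
  rw [image_add_eq_preimage] at this
  simpa using this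

end Fomin

/-- A strongly continuous semigroup on a Banach space is jointly continuous. -/
theorem IsStronglyContinuousSemigroup.continuous_uncurry {X : Type*} [NormedAddCommGroup X]
    [NormedSpace ℝ X] [CompleteSpace X] {T : ℝ≥0 → X →L[ℝ] X}
    (h : IsStronglyContinuousSemigroup T) : Continuous fun p : ℝ≥0 × X => T p.1 p.2 := by
  rw [continuous_iff_continuousAt]
  rintro ⟨t, x⟩
  -- Orbits are bounded on the compact `[0, t + 1]`, hence the operators are uniformly bounded
  -- there.
  obtain ⟨C, hC⟩ := banach_steinhaus (g := fun s : Set.Icc (0 : ℝ≥0) (t + 1) => T s) fun y => by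
    obtain ⟨C, hC⟩ := isCompact_Icc.exists_bound_of_continuousOn
      (h.continuous y).continuousOn (s := Set.Icc 0 (t + 1))
    exact ⟨C, fun s => hC s s.2⟩
  have hlim : Tendsto (fun p : ℝ≥0 × X => C * ‖p.2 - x‖ + ‖T p.1 x - T t x‖) (𝓝 (t, x)) (𝓝 0) := by
    have hc : Continuous fun p : ℝ≥0 × X => C * ‖p.2 - x‖ + ‖T p.1 x - T t x‖ := by
      have : Continuous fun p : ℝ≥0 × X => T p.1 x := (h.continuous x).comp continuous_fst
      exact ((continuous_snd.sub continuous_const).norm.const_mul C).add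
        (this.sub continuous_const).norm
    simpa using hc.tendsto (t, x)
  refine tendsto_iff_norm_sub_tendsto_zero.2
    (squeeze_zero' (Eventually.of_forall fun _ => norm_nonneg _) ?_ hlim)
  have hev : ∀ᶠ p : ℝ≥0 × X in 𝓝 (t, x), p.1 < t + 1 :=
    continuous_fst.tendsto (t, x) (gt_mem_nhds (lt_add_one t))
  filter_upwards [hev] with p hp
  calc ‖T p.1 p.2 - T t x‖ = ‖T p.1 (p.2 - x) + (T p.1 x - T t x)‖ := by rw [map_sub]; abel_nf
    _ ≤ ‖T p.1 (p.2 - x)‖ + ‖T p.1 x - T t x‖ := norm_add_le _ _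
    _ ≤ C * ‖p.2 - x‖ + ‖T p.1 x - T t x‖ := by
      gcongr
      exact (T p.1).le_of_opNorm_le (hC ⟨p.1, zero_le, hp.le⟩) _

/-! ### The Mehler operators: semigroup law, smoothing and joint continuity. -/

section Mehler

variable {X : Type*} [NormedAddCommGroup X] [MeasurableSpace X]

lemma abs_integral_translate_le {ν : Measure X} [IsProbabilityMeasure ν] {f : X → ℝ} {M : ℝ}
    (hM : ∀ x, |f x| ≤ M) (z : X) : |∫ y, f (z + y) ∂ν| ≤ M := by
  have := norm_integral_le_of_norm_le_const (μ := ν) (f := fun y => f (z + y))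
    (Eventually.of_forall fun y => hM (z + y))
  simpa using this

variable [BorelSpace X]

lemma integrable_translate {ν : Measure X} [IsFiniteMeasure ν] {f : X → ℝ} (hf : Measurable f)
    {M : ℝ} (hM : ∀ x, |f x| ≤ M) (z : X) : Integrable (fun y => f (z + y)) ν :=
  Integrable.of_bound (hf.comp (measurable_const_add z)).aestronglyMeasurable M
    (Eventually.of_forall fun _ => hM _)

/-- Translation and weak convergence are jointly continuous at Radon probability measures. -/
theorem continuousAt_integral_translate {f : X → ℝ} (hf : Continuous f) {M : ℝ}
    (hM : ∀ x, |f x| ≤ M) (z : X) (ν : ProbabilityMeasure X)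
    (hν : (ν : Measure X).InnerRegular) :
    ContinuousAt (fun p : X × ProbabilityMeasure X => ∫ y, f (p.1 + y) ∂(p.2 : Measure X))
      (z, ν) := by
  have hM0 : 0 ≤ M := (abs_nonneg _).trans (hM 0)
  refine Metric.tendsto_nhds.2 fun ε hε => ?_
  obtain ⟨δ, hδ, hδ1, hδM⟩ : ∃ δ : ℝ, 0 < δ ∧ δ ≤ 1 ∧ 2 * M * δ < ε / 3 := by
    refine ⟨min 1 (ε / (6 * M + 6)), by positivity, min_le_left _ _, ?_⟩
    refine (mul_le_mul_of_nonneg_left (min_le_right _ _) (by positivity)).trans_lt ?_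
    rw [← mul_div_assoc, div_lt_div_iff₀ (by positivity) (by positivity)]
    nlinarith
  obtain ⟨K, -, hK, hKν⟩ := MeasurableSet.univ.exists_isCompact_lt_add
    (measure_ne_top (ν : Measure X) _) (ENNReal.ofReal_pos.2 hδ).ne'
  have hopen : IsOpen {q : X × X | |f (q.1 + q.2) - f (z + q.2)| < ε / 3} :=
    isOpen_lt (by fun_prop) continuous_const
  -- The compact `K` is enlarged to an open `U`: portmanteau bounds the mass of open sets from
  -- below, so nearby measures also give `Uᶜ` mass at most `δ`.
  obtain ⟨V, U, hV, hU, hzV, hKU, hVU⟩ := generalized_tube_lemma (isCompact_singleton (x := z)) hK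
    hopen (by rintro ⟨a, b⟩ ⟨ha, -⟩; simp only [Set.mem_singleton_iff] at ha; simp [ha, hε])
  have hlt : 1 - ENNReal.ofReal δ < (ν : Measure X) U := by
    rw [measure_univ] at hKν
    refine ENNReal.sub_lt_of_lt_add ?_ (hKν.trans_le (by gcongr))
    exact ENNReal.ofReal_le_one.2 hδ1
  have hevU : ∀ᶠ ρ : ProbabilityMeasure X in 𝓝 ν, (ρ : Measure X).real Uᶜ ≤ δ := by
    have h1 := hlt.trans_le (ProbabilityMeasure.le_liminf_measure_open_of_tendsto
      (tendsto_id (x := 𝓝 ν)) hU)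
    filter_upwards [eventually_lt_of_lt_liminf h1] with ρ hρ
    refine ENNReal.toReal_le_of_le_ofReal hδ.le ?_
    rw [prob_compl_eq_one_sub hU.measurableSet, tsub_le_iff_left]
    exact tsub_le_iff_right.1 hρ.le
  have hevI : ∀ᶠ ρ : ProbabilityMeasure X in 𝓝 ν,
      |∫ y, f (z + y) ∂(ρ : Measure X) - ∫ y, f (z + y) ∂(ν : Measure X)| < ε / 3 := by
    let g : BoundedContinuousFunction X ℝ := BoundedContinuousFunction.ofNormedAddCommGroup
      (fun y => f (z + y)) (by fun_prop) M fun y => hM _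
    exact Metric.tendsto_nhds.1
      (ProbabilityMeasure.tendsto_iff_forall_integral_tendsto.1 (tendsto_id (x := 𝓝 ν)) g)
      (ε / 3) (by positivity)
  rw [nhds_prod_eq]
  filter_upwards [prod_mem_prod (hV.mem_nhds (hzV rfl)) (hevU.and hevI)] with p hp
  obtain ⟨hpV, hpU, hpI⟩ := hp
  have hdiff : |∫ y, f (p.1 + y) ∂(p.2 : Measure X) - ∫ y, f (z + y) ∂(p.2 : Measure X)| ≤
      ε / 3 + 2 * M * δ := by
    have i1 := integrable_translate (ν := (p.2 : Measure X)) hf.measurable hM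
    have hiU : Integrable (Uᶜ.indicator fun _ : X => 2 * M) (p.2 : Measure X) :=
      (integrable_const _).indicator hU.measurableSet.compl
    rw [← integral_sub (i1 _) (i1 _), ← Real.norm_eq_abs]
    calc _ ≤ ∫ y, (ε / 3 + Uᶜ.indicator (fun _ : X => 2 * M) y) ∂(p.2 : Measure X) := by
          refine norm_integral_le_of_norm_le ((integrable_const _).add hiU)
            (Eventually.of_forall fun y => ?_)
          by_cases hy : y ∈ U
          · have : |f (p.1 + y) - f (z + y)| < ε / 3 := hVU (Set.mk_mem_prod hpV hy)
            simpa [hy] using this.le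
          · have := abs_sub (f (p.1 + y)) (f (z + y))
            simp only [Set.indicator, Set.mem_compl_iff, hy, not_false_eq_true, if_true,
              Real.norm_eq_abs]
            linarith [hM (p.1 + y), hM (z + y)]
      _ = ε / 3 + 2 * M * (p.2 : Measure X).real Uᶜ := by
          rw [integral_add (integrable_const _) hiU,
            integral_indicator_const _ hU.measurableSet.compl]
          simp [mul_comm]
      _ ≤ _ := by gcongr
  rw [Real.dist_eq]
  calc _ ≤ |∫ y, f (p.1 + y) ∂(p.2 : Measure X) - ∫ y, f (z + y) ∂(p.2 : Measure X)| +
        |∫ y, f (z + y) ∂(p.2 : Measure X) - ∫ y, f (z + y) ∂(ν : Measure X)| :=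
        abs_sub_le _ _ _
    _ < ε := by linarith

variable [NormedSpace ℝ X] {T : ℝ≥0 → X →L[ℝ] X} {μ : ℝ≥0 → ProbabilityMeasure X} {θ : ℝ}

lemma abs_mehlerOp_le (t : ℝ≥0) {f : X → ℝ} {M : ℝ} (hM : ∀ x, |f x| ≤ M) (x : X) :
    |mehlerOp T μ t f x| ≤ M :=
  abs_integral_translate_le hM _

/-- The semigroup law of the generalized Mehler semigroup. -/
theorem IsGeneralizedMehler.mehlerOp_add (h : IsGeneralizedMehler T μ) {t s : ℝ≥0} (ht : 0 < t)
    (hs : 0 < s) {f : X → ℝ} (hf : Measurable f) {M : ℝ} (hM : ∀ x, |f x| ≤ M) :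
    mehlerOp T μ (t + s) f = mehlerOp T μ t (mehlerOp T μ s f) := by
  funext x
  have hconv := h.conv t s ht hs
  have hT : T (t + s) = (T s).comp (T t) := by rw [add_comm]; exact h.semigroup.add s t
  have hprob := Measure.isProbabilityMeasure_map (μ := (μ t : Measure X))
    (T s).measurable.aemeasurable
  -- `X` need not be separable, so addition may fail to be measurable for the product σ-algebra. If
  -- it were not a.e. measurable, the convolution would be the zero measure, yet it equals the
  -- probability measure `μ (t + s)`.
  have hadd : AEMeasurable (fun p : X × X => p.1 + p.2)
      (((μ t : Measure X).map (T s)).prod (μ s : Measure X)) := by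
    by_contra hcon
    rw [Measure.conv, Measure.map_of_not_aemeasurable hcon] at hconv
    exact IsProbabilityMeasure.ne_zero _ hconv
  have hg : Measurable fun y => f (T (t + s) x + y) := hf.comp (measurable_const_add _)
  have hint : Integrable (fun p : X × X => f (T (t + s) x + (p.1 + p.2)))
      (((μ t : Measure X).map (T s)).prod (μ s : Measure X)) :=
    Integrable.of_bound (hg.comp_aemeasurable hadd).aestronglyMeasurable M
      (Eventually.of_forall fun _ => hM _)
  simp only [mehlerOp]
  rw [hconv, Measure.conv, integral_map hadd hg.aestronglyMeasurable, integral_prod _ hint,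
    integral_map (T s).measurable.aemeasurable hint.aestronglyMeasurable.integral_prod_right']
  simp [hT, add_assoc]

/-- For `t > 0` the operator `P t` maps bounded Borel functions to Lipschitz functions. -/
theorem MehlerSmoothing.exists_lipschitz (h : MehlerSmoothing T μ θ) {t : ℝ≥0} (ht : 0 < t) :
    ∃ K : ℝ, 0 ≤ K ∧ ∀ (f : X → ℝ) (M : ℝ), Measurable f → (∀ x, |f x| ≤ M) →
      ∀ x k, |mehlerOp T μ t f (x + k) - mehlerOp T μ t f x| ≤ K * M * ‖k‖ := by
  obtain ⟨C, hC, ω, hb⟩ := h.bound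
  refine ⟨2 * (C * Real.exp (ω * t) / (t : ℝ) ^ θ), by positivity, fun f M hf hM x k => ?_⟩
  have hM0 : 0 ≤ M := (abs_nonneg _).trans (hM 0)
  -- `bound` only constrains a given derivative, so the existence of one is essential here.
  obtain ⟨β, hβ⟩ := (h.differentiable t ht k).exists_isFominDerivative
  have h1 := hβ.abs_integral_add_sub_le (hf.comp (measurable_const_add (T t x)))
    fun y => hM (T t x + y)
  have e : mehlerOp T μ t f (x + k) =
      ∫ y, (f ∘ fun y => T t x + y) (y + T t k) ∂(μ t : Measure X) := by
    simp only [mehlerOp, map_add, Function.comp_apply]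
    refine integral_congr_ae (Eventually.of_forall fun y => ?_)
    simp only [add_assoc, add_comm y]
  rw [e]
  refine h1.trans ((mul_le_mul_of_nonneg_right (hb t ht k β hβ) (by positivity)).trans_eq ?_)
  ring

theorem MehlerSmoothing.continuous_mehlerOp (h : MehlerSmoothing T μ θ) {t : ℝ≥0} (ht : 0 < t)
    {f : X → ℝ} (hf : IsBoundedBorel f) : Continuous (mehlerOp T μ t f) := by
  obtain ⟨K, -, hK⟩ := h.exists_lipschitz ht
  obtain ⟨hm, M, hM⟩ := hf
  exact DiffBounded.continuous (C := K * M) fun k x => hK f M hm hM x k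

theorem MehlerSmoothing.isStrongFeller (h : MehlerSmoothing T μ θ) {t : ℝ≥0} (ht : 0 < t) :
    IsStrongFeller (mehlerOp T μ t) := fun _ hf =>
  ⟨h.continuous_mehlerOp ht hf, hf.2.imp fun _ hM => abs_mehlerOp_le t hM⟩

/-- Iterated differences of `P t f` of all orders are bounded in terms of `sup |f|`. -/
theorem MehlerSmoothing.exists_diffBounded (h : MehlerSmoothing T μ θ)
    (hμ : IsGeneralizedMehler T μ) (n : ℕ) : ∀ t : ℝ≥0, 0 < t → ∃ C : ℝ, 0 ≤ C ∧
      ∀ (f : X → ℝ) (M : ℝ), Measurable f → (∀ x, |f x| ≤ M) →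
        DiffBounded n (C * M) (mehlerOp T μ t f) := by
  induction n with
  | zero =>
    refine fun t _ => ⟨1, zero_le_one, fun f M _ hM x => ?_⟩
    rw [one_mul]
    exact abs_mehlerOp_le t hM x
  | succ n ih =>
    intro t ht
    have ht2 : 0 < t / 2 := half_pos ht
    obtain ⟨C, hC, hCb⟩ := ih (t / 2) ht2
    obtain ⟨K, hK, hKb⟩ := h.exists_lipschitz ht2
    -- `K` bounds the inner difference in sup norm; `C` is the order `n` constant of the outer
    -- `P_{t/2}`.
    refine ⟨C * K * ‖T (t / 2)‖, by positivity, fun f M hf hM k => ?_⟩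
    have hM0 : 0 ≤ M := (abs_nonneg _).trans (hM 0)
    have hc : Continuous (mehlerOp T μ (t / 2) f) := h.continuous_mehlerOp ht2 ⟨hf, M, hM⟩
    have e : fwdDiff k (mehlerOp T μ t f) =
        mehlerOp T μ (t / 2) (fwdDiff (T (t / 2) k) (mehlerOp T μ (t / 2) f)) := by
      conv_lhs => rw [← add_halves t, hμ.mehlerOp_add ht2 ht2 hf hM]
      funext x
      have hb := abs_mehlerOp_le (T := T) (μ := μ) (t / 2) hM
      rw [fwdDiff, mehlerOp, mehlerOp, mehlerOp,
        ← integral_sub (integrable_translate hc.measurable hb _)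
        (integrable_translate hc.measurable hb _)]
      refine integral_congr_ae (Eventually.of_forall fun y => ?_)
      simp only [fwdDiff, map_add, add_assoc, add_comm y]
    rw [e]
    refine (hCb _ (K * M * ‖T (t / 2) k‖) ?_ fun x => hKb f M hf hM x _).mono ?_
    · exact (hc.measurable.comp (measurable_add_const _)).sub hc.measurable
    · calc C * (K * M * ‖T (t / 2) k‖) ≤ C * (K * M * (‖T (t / 2)‖ * ‖k‖)) := by
            gcongr; exact (T (t / 2)).le_opNorm k
        _ = _ := by ring

theorem MehlerSmoothing.isBoundedContDiff (h : MehlerSmoothing T μ θ)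
    (hμ : IsGeneralizedMehler T μ) {f : X → ℝ} (hf : IsBoundedBorel f) {t : ℝ≥0} (ht : 0 < t)
    (k : ℕ) : IsBoundedContDiff k (mehlerOp T μ t f) := by
  obtain ⟨hm, M, hM⟩ := hf
  refine isBoundedContDiff_of_diffBounded (fun n => ?_) k
  obtain ⟨C, hC, hb⟩ := h.exists_diffBounded hμ n t ht
  exact ⟨C * M, mul_nonneg hC ((abs_nonneg _).trans (hM 0)), hb f M hm hM⟩

theorem IsGeneralizedMehler.continuous_uncurry [CompleteSpace X] (h : IsGeneralizedMehler T μ)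
    (hR : ∀ t, (μ t : Measure X).InnerRegular) {f : X → ℝ} (hf : IsBoundedContinuous f) :
    Continuous fun p : ℝ≥0 × X => mehlerOp T μ p.1 f p.2 := by
  obtain ⟨hc, M, hM⟩ := hf
  rw [continuous_iff_continuousAt]
  intro p
  have hmap : Continuous fun p : ℝ≥0 × X => (T p.1 p.2, μ p.1) :=
    h.semigroup.continuous_uncurry.prodMk (h.weaklyContinuous.comp continuous_fst)
  exact (continuousAt_integral_translate hc hM (T p.1 p.2) (μ p.1) (hR p.1)).comp
    (f := fun p : ℝ≥0 × X => (T p.1 p.2, μ p.1)) hmap.continuousAt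

/-- Half of the time is spent on smoothing: `P_{t/2} f` is bounded and continuous, so the continuous
case applies to it. -/
theorem MehlerSmoothing.continuousOn_uncurry [CompleteSpace X] (h : MehlerSmoothing T μ θ)
    (hμ : IsGeneralizedMehler T μ) {f : X → ℝ} (hf : IsBoundedBorel f) :
    ContinuousOn (fun p : ℝ≥0 × X => mehlerOp T μ p.1 f p.2) (Set.Ioi 0 ×ˢ Set.univ) := by
  rintro ⟨t, x⟩ ⟨ht, -⟩
  have ht' : 0 < t := ht
  have ht2 : 0 < t / 2 := half_pos ht'
  have hc := hμ.continuous_uncurry h.radon (h.isStrongFeller ht2 f hf)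
  have hsub : Continuous fun p : ℝ≥0 × X => (p.1 - t / 2, p.2) :=
    (continuous_fst.sub continuous_const).prodMk continuous_snd
  refine ((hc.comp hsub).continuousAt.congr ?_).continuousWithinAt
  -- Subtraction in `ℝ≥0` is truncated and the semigroup law needs positive times, hence the
  -- restriction to `t / 2 < p.1`.
  have hev : ∀ᶠ p : ℝ≥0 × X in 𝓝 (t, x), t / 2 < p.1 :=
    continuous_fst.tendsto (t, x) (lt_mem_nhds (NNReal.half_lt_self ht'.ne'))
  obtain ⟨hm, M, hM⟩ := hf
  filter_upwards [hev] with p hp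
  have := hμ.mehlerOp_add (tsub_pos_of_lt hp) ht2 hm hM
  rw [tsub_add_cancel_of_le hp.le] at this
  simp only [Function.comp_apply, this]

end Mehler

theorem mainTheorem8 {X : Type*} [NormedAddCommGroup X] [NormedSpace ℝ X] [CompleteSpace X]
    [MeasurableSpace X] [BorelSpace X]
    (T : ℝ≥0 → X →L[ℝ] X) (μ : ℝ≥0 → ProbabilityMeasure X) (θ : ℝ)
    (hMehler : IsGeneralizedMehler T μ) (hSmooth : MehlerSmoothing T μ θ) :
    (∀ f : X → ℝ, IsBoundedBorel f → ∀ t : ℝ≥0, 0 < t → ∀ k : ℕ,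
      IsBoundedContDiff k (mehlerOp T μ t f)) ∧
    (∀ t : ℝ≥0, 0 < t → IsStrongFeller (mehlerOp T μ t)) ∧
    (∀ f : X → ℝ, IsBoundedBorel f →
      ContinuousOn (fun p : ℝ≥0 × X => mehlerOp T μ p.1 f p.2) (Set.Ioi 0 ×ˢ Set.univ)) ∧
    (∀ f : X → ℝ, IsBoundedContinuous f →
      Continuous (fun p : ℝ≥0 × X => mehlerOp T μ p.1 f p.2)) :=
  ⟨fun _ hf _ ht k => hSmooth.isBoundedContDiff hMehler hf ht k,
    fun _ ht => hSmooth.isStrongFeller ht,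
    fun _ hf => hSmooth.continuousOn_uncurry hMehler hf,
    fun _ hf => hMehler.continuous_uncurry hSmooth.radon hf⟩
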